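/- Let $n>k\ge 2$. For a loopless digraph $D=(V,E)$ let the flow semigroup $S_D$ be the semigroup of transformations of $V$ generated by the elementary collapsings $e_{uv}$, $uv\in E$, where $e_{uv}$ maps $u$ to $v$ and fixes all other vertices; for a simple graph $\Gamma$ let $S_\Gamma$ be the flow semigroup of the digraph obtained by directing every edge of $\Gamma$ both ways. For $V_k\subseteq V$ with $|V_k|=k$, the defect $k$ group of $D$ (or of $\Gamma$) with defect set $V_k$ is the group of permutations of $V\setminus V_k$ generated by the restrictions $s\restriction_{V\setminus V_k}$ of those elements $s$ of the flow semigroup with $(V\setminus V_k)s=V\setminus V_k$ and $V_ks\subseteq V\setminus V_k$. (a) Let $\Gamma$ be a $2$-edge connected simple graph on $n$ vertices. For every set $V_k$ of $k$ vertices, the defect $k$ group of $\Gamma$ with defect set $V_k$ is isomorphic, as a permutation group, to the cyclic group $Z_{n-k}$ generated by the rotation of $n-k$ points if $\Gamma$ is a cycle, and to the full symmetric group $S_{n-k}$ on $n-k$ points otherwise. (b) Let $D$ be a strongly connected digraph on $n$ vertices without loops that is antisymmetric (at most one of $uv$, $vu$ is an edge for any vertices $u,v$). For every set $V_k$ of $k$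 vertices, the defect $k$ group of $D$ with defect set $V_k$ is isomorphic, as a permutation group, to $Z_{n-k}$ (generated by the rotation of $n-k$ points) if the simple graph obtained from $D$ by forgetting directions is a cycle, and to the full symmetric group $S_{n-k}$ on $n-k$ points otherwise. -/

import Mathlib

/-- The elementary collapsing `e_{uv}`: the transformation moving `u` to `v` and fixing every
other vertex. -/
def elemCollapse {V : Type*} [DecidableEq V] (u v : V) : Function.End V :=
  fun x => if x = u then v else x

/-- The flow semigroup (Rhodes semigroup) `S_D` of a digraph `D`: the semigroup of transformations
of the vertices generated, without adjoining the identity, by the elementary collapsings of the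
arcs of `D`. (The product of `Function.End V` composes functions from right to left; the set of
transformations generated is the same for either order of composition.) -/
def Digraph.flowSemigroup {V : Type*} [DecidableEq V] (D : Digraph V) :
    Subsemigroup (Function.End V) :=
  Subsemigroup.closure {e | ∃ u v : V, D.Adj u v ∧ e = elemCollapse u v}

/-- A simple graph as a digraph: every edge is directed both ways. -/
def SimpleGraph.bidirected {V : Type*} (Γ : SimpleGraph V) : Digraph V where
  Adj := Γ.Adj

/-- The flow semigroup `S_Γ` of a simple graph. -/
def SimpleGraph.flowSemigroup {V : Type*} [DecidableEq V] (Γ : SimpleGraph V) :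
    Subsemigroup (Function.End V) :=
  Γ.bidirected.flowSemigroup

/-- The defect group `G_{k, W}` of a transformation semigroup `S` on `V` with defect set `W`
(where `k` is the size of `W`): the group of permutations of `V \ W` generated by the restrictions
`s ↾ (V \ W)` of those `s ∈ S` that permute `V \ W` and move all elements of `W` into `V \ W`. -/
def defectGroup {V : Type*} (S : Subsemigroup (Function.End V)) (W : Finset V) :
    Subgroup (Equiv.Perm {x : V // x ∉ W}) :=
  Subgroup.closure
    {σ | ∃ s ∈ S, (∀ x : {x : V // x ∉ W}, s x.1 = (σ x).1) ∧ ∀ x ∈ W, s x ∉ W}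

/-- Two permutation groups are isomorphic as permutation groups: some bijection of the underlying
sets carries one onto the other. In particular they are isomorphic as abstract groups. -/
def PermGroupIso {α β : Type*} (G : Subgroup (Equiv.Perm α)) (H : Subgroup (Equiv.Perm β)) :
    Prop :=
  ∃ e : α ≃ β, G.map e.permCongrHom.toMonoidHom = H

/-- The cyclic group `Z_m`, as the permutation group on `m` points generated by the rotation
`i ↦ i + 1` (mod `m`). -/
def cyclicPermGroup (m : ℕ) : Subgroup (Equiv.Perm (Fin m)) :=
  Subgroup.zpowers (finRotate m)

/-- The full symmetric group `S_m` acting on `m` points. -/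
def symmPermGroup (m : ℕ) : Subgroup (Equiv.Perm (Fin m)) := ⊤

/-- `Γ` is a cycle, i.e. it is isomorphic to the cycle graph on its `n ≥ 3` vertices. -/
def SimpleGraph.IsCycleGraph {V : Type*} (Γ : SimpleGraph V) : Prop :=
  ∃ n : ℕ, 3 ≤ n ∧ Nonempty (Γ ≃g SimpleGraph.cycleGraph n)

/-- Strongly connected: there is a directed path from every vertex to every other vertex. -/
def Digraph.StronglyConnected {V : Type*} (D : Digraph V) : Prop :=
  ∀ u v : V, Relation.ReflTransGen D.Adj u v

/-- Antisymmetric digraph without loops: `uv` and `vu` are never both arcs, and (taking `u = v`)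
no `uu` is an arc. -/
def Digraph.IsAntisymmetric {V : Type*} (D : Digraph V) : Prop :=
  ∀ u v : V, D.Adj u v → ¬ D.Adj v u

/-!
The defect group with defect set `W` is the group of a sliding game: the vertices outside `W` carry
tokens, those in `W` are empty, and a token may move along an arc into an empty vertex. Restricted
to the tokens, an element of the flow semigroup that keeps them apart is a sequence of such moves;
conversely, once `W` has been collapsed into its complement, every sequence of moves comes from the
flow semigroup (`defectGroup_eq_closure_reach`).

In a strongly connected digraph every move can be undone: driving a hole once around a closed walk
is a permutation of finite order (`Reach.slide_reverse`). Hence the game on an antisymmetric digraph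
is the game on the underlying simple graph, and this graph has no bridge
(`Digraph.IsAntisymmetric.isEdgeConnected_two`), so that digraphs reduce to simple graphs.

On a cycle the moves preserve the cyclic order of the tokens (`tokenList_isRotated`), which leaves
only the rotations. A token can be taken to the place of the next one, because deleting a vertex
leaves the cycle connected, and so the rotation itself occurs
(`permGroupIso_cyclicPermGroup_slideGroup`).

A `2`-edge connected graph that is not a cycle has a vertex `v` with three neighbours. Two holes
suffice for the rest. With the holes at `v` and at one neighbour, the tokens at the two other
neighbours can be exchanged (`interchangeable_of_star`). So this star with three leaves is mixing:
whenever both holes are in it, its tokens are interchangeable. Because there is no bridge, a mixing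
set that does not contain all vertices can be enlarged by a vertex (`Mixing.exists_insert`): either
another star performs an exchange, or a token is fed into the set at one vertex while another token
leaves it at a different vertex. In the end any two tokens are interchangeable, and
transpositions generate the symmetric group.
-/

open Equiv Relation

/-! ### The sliding game and the flow semigroup -/

section Sliding

variable {V : Type*} [DecidableEq V]

/-- A state of the sliding game is a permutation `π` of the vertices, sending each label to its
current position. The labels in `W` are the holes, all others are tokens. A slide along an arc `u
→ v` with a hole at `v` exchanges the contents of `u` and `v`; the hole thus moves against the
arc. If `u` holds a hole as well, two holes are exchanged and no token moves. Keeping labels on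
the holes makes every slide a left multiplication by a transposition. -/
def Slide (r : V → V → Prop) (W : Finset V) (π π' : Perm V) : Prop :=
  ∃ u v, r u v ∧ π.symm v ∈ W ∧ π' = swap u v * π

/-- The state `π'` can be reached from the state `π` by a sequence of slides. -/
def Reach (r : V → V → Prop) (W : Finset V) : Perm V → Perm V → Prop :=
  ReflTransGen (Slide r W)

variable {r : V → V → Prop} {W : Finset V} {π π' π'' : Perm V}

theorem Reach.refl (π : Perm V) : Reach r W π π := ReflTransGen.refl

theorem Reach.trans (h : Reach r W π π') (h' : Reach r W π' π'') : Reach r W π π'' :=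
  ReflTransGen.trans h h'

theorem Reach.slide {u v : V} (huv : r u v) (hv : π.symm v ∈ W) :
    Reach r W π (swap u v * π) :=
  ReflTransGen.single ⟨u, v, huv, hv, rfl⟩

theorem Reach.mono_holes {W' : Finset V} (hW : W ⊆ W') (h : Reach r W π π') :
    Reach r W' π π' :=
  ReflTransGen.mono (fun _ _ ⟨u, v, huv, hv, e⟩ => ⟨u, v, huv, hW hv, e⟩) _ _ h

theorem Reach.mul_right {τ : Perm V} (hτ : ∀ x, τ x ∈ W ↔ x ∈ W) (h : Reach r W π π') :
    Reach r W (π * τ) (π' * τ) := by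
  refine ReflTransGen.lift (· * τ) ?_ _ _ h
  rintro π₁ _ ⟨u, v, huv, hv, rfl⟩
  refine ⟨u, v, huv, ?_, by simp [mul_assoc]⟩
  rw [← hτ]
  simpa [Perm.mul_def] using hv

theorem Reach.symm (hr : ∀ u v, r u v → r v u) (h : Reach r W π π') : Reach r W π' π := by
  refine (@ReflTransGen.stdSymm _ (Slide r W) ⟨?_⟩).symm _ _ h
  rintro π₁ _ ⟨u, v, huv, hv, rfl⟩
  refine ⟨v, u, hr _ _ huv, ?_, ?_⟩
  · simpa [Perm.mul_def] using hv
  · rw [swap_comm v u, ← mul_assoc, swap_mul_self, one_mul]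

/-- A hole can be driven along any walk inside `A` running against the arcs. The permutation `τ`
of the positions depends on the walk alone, not on the state or on where the other holes are; this
uniformity is what `Reach.slide_reverse` relies on. -/
theorem exists_hole_walk {A : Set V} {a b : V}
    (h : ReflTransGen (fun x y => r y x ∧ x ∈ A ∧ y ∈ A) a b) :
    ∃ τ : Perm V, τ a = b ∧ (∀ x ∉ A, τ x = x) ∧
      ∀ (W : Finset V) (π : Perm V), π.symm a ∈ W → Reach r W π (τ * π) := by
  induction h with
  | refl => exact ⟨1, rfl, fun _ _ => rfl, fun _ π _ => by simpa using Reach.refl π⟩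
  | @tail b c _ hbc ih =>
    obtain ⟨τ, hτ, hfix, hreach⟩ := ih
    obtain ⟨hcb, hb, hc⟩ := hbc
    refine ⟨swap c b * τ, by simp [hτ], fun x hx => ?_, fun W π hπ => ?_⟩
    · rw [Perm.mul_apply, hfix x hx, swap_apply_of_ne_of_ne]
      · rintro rfl; exact hx hc
      · rintro rfl; exact hx hb
    · rw [mul_assoc]
      refine (hreach W π hπ).trans (Reach.slide hcb ?_)
      rw [← hτ]
      simpa [Perm.mul_def] using hπ

/-- A slide along an arc `a → b` that lies on a directed closed walk can be undone. If `τ` drives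
the hole from `a` to `b` along the rest of the closed walk, then `ρ = swap a b * τ` brings it back
to `a`, so every power of `ρ` can be performed. Since `ρ` has finite order, `ρ⁻¹` is among these,
and `τ * ρ⁻¹ = swap a b`. -/
theorem Reach.slide_reverse [Finite V] {a b : V} (hab : r a b) (hba : ReflTransGen r b a)
    (ha : π.symm a ∈ W) : Reach r W π (swap a b * π) := by
  have hwalk : ReflTransGen (fun x y => r y x ∧ x ∈ Set.univ ∧ y ∈ Set.univ) a b := by
    simpa [ReflTransGen.swap] using (reflTransGen_swap (r := r)).2 hba
  obtain ⟨τ, hτ, -, hreach⟩ := exists_hole_walk hwalk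
  set ρ : Perm V := swap a b * τ with hρ
  have hρa : ρ a = a := by simp [hρ, hτ]
  have hsymm : ∀ (σ : Perm V), σ a = a → (σ * π).symm a ∈ W := by
    intro σ hσ
    have : (σ * π).symm a = π.symm a := by
      rw [symm_apply_eq, Perm.mul_apply, apply_symm_apply, hσ]
    rwa [this]
  have hstep : ∀ σ : Perm V, σ a = a → Reach r W (σ * π) (ρ * (σ * π)) := by
    intro σ hσ
    rw [hρ, mul_assoc]
    refine (hreach W _ (hsymm σ hσ)).trans (Reach.slide hab ?_)
    have : (τ * (σ * π)).symm b = (σ * π).symm a := by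
      rw [symm_apply_eq, Perm.mul_apply, apply_symm_apply, hτ]
    rw [this]
    exact hsymm σ hσ
  have hpow : ∀ j : ℕ, (ρ ^ j) a = a ∧ Reach r W π (ρ ^ j * π) := by
    intro j
    induction j with
    | zero => exact ⟨rfl, by simpa using Reach.refl π⟩
    | succ j ih =>
      refine ⟨by rw [pow_succ, Perm.mul_apply, hρa, ih.1], ?_⟩
      rw [pow_succ', mul_assoc]
      exact ih.2.trans (hstep _ ih.1)
  obtain ⟨j, hj⟩ : ∃ j : ℕ, ρ ^ j = ρ⁻¹ := by
    have : ρ⁻¹ ∈ Submonoid.powers ρ := by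
      rw [mem_powers_iff_mem_zpowers]
      exact Subgroup.inv_mem _ (Subgroup.mem_zpowers ρ)
    exact this
  have h := hpow j
  refine h.2.trans ?_
  -- after `ρ⁻¹`, which fixes the hole at `a`, drive the hole from `a` to `b`
  convert hreach W _ (hsymm _ h.1) using 1
  rw [hj, hρ]
  group
  simp

/-- In a strongly connected digraph the orientation of the arcs does not affect reachability of
states. -/
theorem reach_iff_of_stronglyConnected [Finite V] {r' : V → V → Prop}
    (hconn : ∀ u v, ReflTransGen r u v) (hr : ∀ u v, r u v → r' u v)
    (hr' : ∀ u v, r' u v → r u v ∨ r v u) :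
    Reach r' W π π' ↔ Reach r W π π' := by
  constructor
  · intro h
    induction h with
    | refl => exact Reach.refl π
    | tail _ h ih =>
      obtain ⟨u, v, huv, hv, rfl⟩ := h
      refine ih.trans ?_
      rcases hr' u v huv with h | h
      · exact Reach.slide h hv
      · rw [swap_comm]
        exact Reach.slide_reverse h (hconn _ _) hv
  · exact ReflTransGen.mono (fun _ _ ⟨u, v, huv, hv, e⟩ => ⟨u, v, hr _ _ huv, hv, e⟩) _ _

/-- As long as the tokens stay on distinct vertices, an element of the flow semigroup acts on them
as a sequence of slides. -/
theorem exists_reach_of_mem_flowSemigroup {D : Digraph V} {s : Function.End V}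
    (hs : s ∈ D.flowSemigroup) (π : Perm V) (hinj : Set.InjOn (fun x => s (π x)) {x | x ∉ W}) :
    ∃ π', Reach D.Adj W π π' ∧ ∀ x ∉ W, π' x = s (π x) := by
  induction hs using Subsemigroup.closure_induction generalizing π with
  | mem s hs =>
    obtain ⟨u, v, huv, rfl⟩ := hs
    by_cases huW : π.symm u ∈ W ∨ u = v
    · refine ⟨π, Reach.refl π, fun x hx => ?_⟩
      simp only [elemCollapse]
      split_ifs with h
      · rcases huW with hu | hu
        · exact absurd (by simpa [← h] using hu) hx
        · rw [h, hu]
      · rfl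
    · push Not at huW
      have hv : π.symm v ∈ W := by
        by_contra hv
        have := hinj huW.1 hv (by simp [elemCollapse])
        exact huW.2 (π.symm.injective this)
      refine ⟨swap u v * π, Reach.slide huv hv, fun x hx => ?_⟩
      have hxv : π x ≠ v := by rintro rfl; exact hx (by simpa using hv)
      simp only [elemCollapse, Perm.mul_apply, swap_apply_def, if_neg hxv]
  | mul s t _ _ ihs iht =>
    obtain ⟨π₁, h₁, e₁⟩ := iht π fun x hx y hy hxy => hinj hx hy (congrArg s hxy)
    obtain ⟨π₂, h₂, e₂⟩ := ihs π₁ fun x hx y hy hxy => by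
      refine hinj hx hy ?_
      change s (t (π x)) = s (t (π y))
      simpa only [e₁ x hx, e₁ y hy] using hxy
    exact ⟨π₂, h₁.trans h₂, fun x hx => by rw [e₂ x hx, e₁ x hx]; rfl⟩

/-- Conversely, a sequence of slides is realized on the tokens by the identity or an element of
the flow semigroup. -/
theorem Reach.exists_transformation {D : Digraph V} (h : Reach D.Adj W π π') :
    ∃ s : Function.End V, (s = 1 ∨ s ∈ D.flowSemigroup) ∧ ∀ x ∉ W, s (π x) = π' x := by
  induction h with
  | refl => exact ⟨1, Or.inl rfl, fun _ _ => rfl⟩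
  | @tail π₁ _ _ h ih =>
    obtain ⟨u, v, huv, hv, rfl⟩ := h
    obtain ⟨s, hs, e⟩ := ih
    have huv' : elemCollapse u v ∈ D.flowSemigroup :=
      Subsemigroup.subset_closure ⟨u, v, huv, rfl⟩
    refine ⟨elemCollapse u v * s, Or.inr ?_, fun x hx => ?_⟩
    · rcases hs with rfl | hs
      · simpa using huv'
      · exact mul_mem huv' hs
    · change elemCollapse u v (s (π x)) = _
      have hxv : π₁ x ≠ v := by rintro rfl; exact hx (by simpa using hv)
      rw [e x hx]
      simp only [elemCollapse, Perm.mul_apply, swap_apply_def, if_neg hxv]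

theorem exists_collapse_vertex {D : Digraph V} {w t : V} (h : ReflTransGen D.Adj w t)
    (ht : t ∉ W) :
    ∃ s : Function.End V, (s = 1 ∨ s ∈ D.flowSemigroup) ∧ (∀ x ∉ W, s x = x) ∧ s w ∉ W := by
  induction h using ReflTransGen.head_induction_on with
  | refl => exact ⟨1, Or.inl rfl, fun _ _ => rfl, ht⟩
  | @head u v huv _ ih =>
    by_cases hu : u ∈ W
    · obtain ⟨s, hs, hfix, hsv⟩ := ih
      have huv' : elemCollapse u v ∈ D.flowSemigroup :=
        Subsemigroup.subset_closure ⟨u, v, huv, rfl⟩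
      refine ⟨s * elemCollapse u v, Or.inr ?_, fun x hx => ?_, ?_⟩
      · rcases hs with rfl | hs
        · simpa using huv'
        · exact mul_mem hs huv'
      · have : x ≠ u := by rintro rfl; exact hx hu
        change s (elemCollapse u v x) = x
        simp [elemCollapse, this, hfix x hx]
      · change s (elemCollapse u v u) ∉ W
        simpa [elemCollapse] using hsv
    · exact ⟨1, Or.inl rfl, fun _ _ => rfl, hu⟩

/-- All of `W` can be collapsed into the complement of `W` while that complement stays fixed
pointwise. -/
theorem exists_collapse_holes {D : Digraph V}
    (hconn : ∀ w, ∃ t ∉ W, ReflTransGen D.Adj w t) :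
    ∃ s : Function.End V, (s = 1 ∨ s ∈ D.flowSemigroup) ∧ (∀ x ∉ W, s x = x) ∧
      ∀ w ∈ W, s w ∉ W := by
  suffices ∀ B : Finset V, ∃ s : Function.End V, (s = 1 ∨ s ∈ D.flowSemigroup) ∧
      (∀ x ∉ W, s x = x) ∧ ∀ w ∈ B, s w ∉ W from this W
  intro B
  induction B using Finset.induction_on with
  | empty => exact ⟨1, Or.inl rfl, fun _ _ => rfl, by simp⟩
  | insert w B _ ih =>
    obtain ⟨s, hs, hfix, hB⟩ := ih
    obtain ⟨t, ht, hwt⟩ := hconn (s w)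
    obtain ⟨s', hs', hfix', hw⟩ := exists_collapse_vertex hwt ht
    refine ⟨s' * s, ?_, fun x hx => ?_, fun x hx => ?_⟩
    · rcases hs with rfl | hs
      · simpa using hs'
      · rcases hs' with rfl | hs'
        · simpa using Or.inr hs
        · exact Or.inr (mul_mem hs' hs)
    · change s' (s x) = x
      rw [hfix x hx, hfix' x hx]
    · change s' (s x) ∉ W
      rcases Finset.mem_insert.1 hx with rfl | hx
      · exact hw
      · rw [hfix' _ (hB x hx)]
        exact hB x hx

/-- The defect group is the group of the sliding game: it is generated by the rearrangements of
the tokens that slides can produce from the initial state. -/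
theorem defectGroup_eq_closure_reach {D : Digraph V} (hW : W.Nonempty)
    (hconn : ∀ w, ∃ t ∉ W, ReflTransGen D.Adj w t) :
    defectGroup D.flowSemigroup W = Subgroup.closure
      {σ | ∃ π, Reach D.Adj W 1 π ∧ ∀ x : {x : V // x ∉ W}, π x = σ x} := by
  unfold defectGroup
  congr 1
  ext σ
  constructor
  · rintro ⟨s, hs, hσ, -⟩
    obtain ⟨π, hπ, e⟩ := exists_reach_of_mem_flowSemigroup (W := W) hs 1 fun x hx y hy hxy => by
      have := (hσ ⟨x, hx⟩).symm.trans (Eq.trans hxy (hσ ⟨y, hy⟩))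
      simpa using σ.injective (Subtype.ext this)
    exact ⟨π, hπ, fun x => (e x x.2).trans (hσ x)⟩
  · rintro ⟨π, hπ, hσ⟩
    obtain ⟨s₀, hs₀, hfix, hout⟩ := exists_collapse_holes hconn
    obtain ⟨s, hs, e⟩ := hπ.exists_transformation
    obtain ⟨w, hw⟩ := hW
    -- `s₀` moves the hole `w`, so it is not the identity
    have hs₀' : s₀ ∈ D.flowSemigroup := by
      rcases hs₀ with rfl | h
      · exact absurd hw (hout w hw)
      · exact h
    refine ⟨s * s₀, ?_, fun x => ?_, fun x hx => ?_⟩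
    · rcases hs with rfl | hs
      · simpa using hs₀'
      · exact mul_mem hs hs₀'
    · change s (s₀ x) = _
      rw [hfix x x.2, ← hσ]
      exact e x x.2
    · change s (s₀ x) ∉ W
      have h := e _ (hout x hx)
      rw [Perm.one_apply] at h
      rw [h, hσ ⟨_, hout x hx⟩]
      exact (σ _).2

end Sliding

/-! ### Moving holes and exchanging tokens -/

section Interchange

variable {V : Type*} {r : V → V → Prop} {W : Finset V} {π : Perm V}

/-- A step along `r` between two elements of `A`. -/
def StepIn (r : V → V → Prop) (A : Set V) (x y : V) : Prop := r x y ∧ x ∈ A ∧ y ∈ A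

/-- The subgraph of `r` induced on `A` is (strongly) connected. -/
def ConnectedIn (r : V → V → Prop) (A : Set V) : Prop :=
  ∀ u ∈ A, ∀ v ∈ A, ReflTransGen (StepIn r A) u v

theorem Relation.ReflTransGen.stepIn_symm {A : Set V} (hr : ∀ u v, r u v → r v u) {u v : V}
    (h : ReflTransGen (StepIn r A) u v) : ReflTransGen (StepIn r A) v u :=
  (@ReflTransGen.stdSymm _ (StepIn r A) ⟨fun _ _ h => ⟨hr _ _ h.1, h.2.2, h.2.1⟩⟩).symm _ _ h

theorem Relation.ReflTransGen.stepIn_mono {A B : Set V} (hAB : A ⊆ B) {u v : V}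
    (h : ReflTransGen (StepIn r A) u v) : ReflTransGen (StepIn r B) u v :=
  ReflTransGen.mono (fun _ _ h => ⟨h.1, hAB h.2.1, hAB h.2.2⟩) _ _ h

theorem ConnectedIn.insert_adj {A : Set V} (hr : ∀ u v, r u v → r v u) (hA : ConnectedIn r A)
    {p y : V} (hp : p ∈ A) (hpy : r p y) : ConnectedIn r (Insert.insert y A) := by
  have key : ∀ u ∈ insert y A, ReflTransGen (StepIn r (Insert.insert y A)) p u := by
    rintro u (rfl | hu)
    · exact ReflTransGen.single ⟨hpy, Or.inr hp, Or.inl rfl⟩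
    · exact (hA p hp u hu).stepIn_mono (Set.subset_insert _ _)
  exact fun u hu v hv => ((key u hu).stepIn_symm hr).trans (key v hv)

/-- In the state `π`, the holes occupy exactly the positions in `H`. -/
def HolesAt (W : Finset V) (π : Perm V) (H : Finset V) : Prop := ∀ x, π.symm x ∈ W ↔ x ∈ H

theorem holesAt_map (W : Finset V) (π : Perm V) : HolesAt W π (W.map π.toEmbedding) := by
  intro x
  simp [Finset.mem_map_equiv]

variable [DecidableEq V]

theorem symm_swap_mul_apply (u v : V) (π : Perm V) (x : V) :
    (swap u v * π).symm x = π.symm (swap u v x) := by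
  rw [symm_apply_eq, Perm.mul_apply, apply_symm_apply, swap_apply_self]

/-- If `u` is a hole and `v` is not, slides inside a connected part containing both can make `v` a
hole in place of `u` and keep the set of the other holes. -/
theorem exists_exchange_hole {A : Set V} (hr : ∀ u v, r u v → r v u) {u v : V}
    (h : ReflTransGen (StepIn r A) u v) (π : Perm V) (hu : π.symm u ∈ W) (hv : π.symm v ∉ W) :
    ∃ τ : Perm V, (∀ x ∉ A, τ x = x) ∧ Reach r W π (τ * π) ∧
      ∀ x, (τ * π).symm x ∈ W ↔ x = v ∨ (x ≠ u ∧ π.symm x ∈ W) := by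
  induction h using ReflTransGen.head_induction_on generalizing π with
  | refl => exact absurd hu hv
  | @head u w huw _ ih =>
    obtain ⟨huw, huA, hwA⟩ := huw
    have hfix : ∀ x ∉ A, swap w u x = x := by
      intro x hx
      rw [swap_apply_of_ne_of_ne]
      · rintro rfl; exact hx hwA
      · rintro rfl; exact hx huA
    have hsw := symm_swap_mul_apply w u
    -- if the next vertex `w` is a hole too, that hole goes on to `v` and `u` moves up to `w`
    by_cases hw : π.symm w ∈ W
    · obtain ⟨τ, hτ, hreach, hholes⟩ := ih π hw hv
      have huv : u ≠ v := by rintro rfl; exact hv hu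
      have huW : (τ * π).symm u ∈ W ∨ u = w := by
        by_cases h : u = w
        · exact Or.inr h
        · exact Or.inl ((hholes u).2 (Or.inr ⟨h, hu⟩))
      rcases huW with huW | rfl
      · refine ⟨swap w u * τ, fun x hx => by rw [Perm.mul_apply, hτ x hx, hfix x hx], ?_, ?_⟩
        · rw [mul_assoc]
          exact hreach.trans (Reach.slide (hr _ _ huw) huW)
        · intro x
          rw [mul_assoc, hsw, hholes]
          have hwv : w ≠ v := by rintro rfl; exact hv hw
          by_cases hxw : x = w
          · subst hxw; simp [swap_apply_left, huv, hwv, hw, hu]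
            grind
          · by_cases hxu : x = u
            · subst hxu; simp [huv, hwv]
            · rw [swap_apply_of_ne_of_ne hxw hxu]; simp [hxw, hxu]
      · exact ⟨τ, hτ, hreach, hholes⟩
    · by_cases hwv : w = v
      · subst hwv
        refine ⟨swap w u, hfix, Reach.slide (hr _ _ huw) hu, fun x => ?_⟩
        rw [hsw]
        by_cases hxw : x = w
        · subst hxw; simp [hu]
        · by_cases hxu : x = u
          · subst hxu; simp [hw, hxw]
          · rw [swap_apply_of_ne_of_ne hxw hxu]; simp [hxw, hxu]
      · have huv : u ≠ v := by rintro rfl; exact hv hu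
        obtain ⟨τ, hτ, hreach, hholes⟩ := ih (swap w u * π) (by rw [hsw]; simpa using hu)
          (by rw [hsw, swap_apply_of_ne_of_ne (Ne.symm hwv) huv.symm]; exact hv)
        refine ⟨τ * swap w u, fun x hx => by rw [Perm.mul_apply, hfix x hx, hτ x hx], ?_, ?_⟩
        · rw [mul_assoc]
          exact (Reach.slide (hr _ _ huw) hu).trans hreach
        · intro x
          rw [mul_assoc, hholes, hsw]
          by_cases hxw : x = w
          · subst hxw; simp [hwv, hw]
          · by_cases hxu : x = u
            · subst hxu; simp [huv, hw]
            · rw [swap_apply_of_ne_of_ne hxw hxu]; simp [hxw, hxu]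

/-- Within a connected part `A`, the set of holes can be moved to any other set of the same size
by slides that affect only positions in `A`. -/
theorem exists_move_holes {A : Set V} (hr : ∀ u v, r u v → r v u) (hA : ConnectedIn r A)
    {H H' : Finset V} (hcard : H.card = H'.card) (hHA : ↑H ⊆ A) (hHA' : ↑H' ⊆ A) (π : Perm V)
    (hπ : HolesAt W π H) :
    ∃ τ : Perm V, (∀ x ∉ A, τ x = x) ∧ Reach r W π (τ * π) ∧ HolesAt W (τ * π) H' := by
  induction hm : (H' \ H).card generalizing H π with
  | zero =>
    have hsub : H' ⊆ H := by simpa [Finset.sdiff_eq_empty_iff_subset] using hm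
    obtain rfl := Finset.eq_of_subset_of_card_le hsub hcard.le
    exact ⟨1, fun _ _ => rfl, by simpa using Reach.refl π, by simpa using hπ⟩
  | succ m ih =>
    obtain ⟨v, hv⟩ : (H' \ H).Nonempty := Finset.card_pos.1 (by omega)
    obtain ⟨u, hu⟩ : (H \ H').Nonempty := by
      rw [← Finset.card_pos, Finset.card_sdiff_comm hcard]; omega
    rw [Finset.mem_sdiff] at hu hv
    obtain ⟨τ, hτ, hreach, hholes⟩ := exists_exchange_hole (W := W) hr
      (hA u (hHA hu.1) v (hHA' hv.1)) π ((hπ u).2 hu.1) (fun h => hv.2 ((hπ v).1 h))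
    obtain ⟨τ', hτ', hreach', hholes'⟩ := ih (H := insert v (H.erase u))
      (by rw [Finset.card_insert_of_notMem (by simp [hv.2]), Finset.card_erase_add_one hu.1, hcard])
      (by
        intro x hx
        rcases Finset.mem_insert.1 hx with rfl | hx
        · exact hHA' hv.1
        · exact hHA (Finset.mem_of_mem_erase hx))
      (τ * π) (by intro x; rw [hholes, hπ]; simp)
      (by
        have : H' \ insert v (H.erase u) = (H' \ H).erase v := by
          ext x
          simp only [Finset.mem_sdiff, Finset.mem_insert, Finset.mem_erase]
          grind
        rw [this, Finset.card_erase_of_mem (by simp [hv]), hm]; rfl)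
    refine ⟨τ' * τ, fun x hx => by rw [Perm.mul_apply, hτ x hx, hτ' x hx], ?_, ?_⟩
    · rw [mul_assoc]; exact hreach.trans hreach'
    · rw [mul_assoc]; exact hholes'

/-- Two labels are interchangeable if slides can realize their transposition from the initial
state. -/
def Interchangeable (r : V → V → Prop) (W : Finset V) (x y : V) : Prop :=
  Reach r W 1 (swap x y)

theorem swap_mem_iff {x y : V} (hx : x ∉ W) (hy : y ∉ W) (z : V) : swap x y z ∈ W ↔ z ∈ W := by
  rw [swap_apply_def]
  split_ifs with h₁ h₂ <;> simp_all

theorem Interchangeable.symm {x y : V} (h : Interchangeable r W x y) :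
    Interchangeable r W y x := by
  unfold Interchangeable; rwa [swap_comm]

theorem Interchangeable.trans {x y z : V} (hx : x ∉ W) (hy : y ∉ W) (hz : z ∉ W)
    (hxy : Interchangeable r W x y) (hyz : Interchangeable r W y z) :
    Interchangeable r W x z := by
  by_cases hxz : x = z
  · subst hxz; rw [Interchangeable, swap_self]; exact Reach.refl _
  by_cases hxy' : x = y
  · subst hxy'; exact hyz
  have key : Reach r W 1 (swap y z * swap x y * swap y z) := by
    have h₁ := hxy.mul_right (swap_mem_iff hy hz)
    have h₂ := hyz.mul_right (swap_mem_iff hx hy)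
    rw [one_mul] at h₁ h₂
    have h₃ := h₂.mul_right (swap_mem_iff hy hz)
    exact (Reach.trans hyz h₁).trans h₃
  have hperm : swap y z * swap x y * swap y z = swap x z := by
    rw [swap_mul_swap_mul_swap hxy' hxz, swap_comm]
  rwa [hperm] at key

/-- Tokens that can be exchanged in some reachable state can be exchanged in the initial state. -/
theorem interchangeable_of_reach {x y : V} (hr : ∀ u v, r u v → r v u) (hx : x ∉ W) (hy : y ∉ W)
    (hπ : Reach r W 1 π) (h : Reach r W π (π * swap x y)) : Interchangeable r W x y := by
  have := hπ.mul_right (swap_mem_iff hx hy)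
  rw [one_mul] at this
  exact (hπ.trans h).trans (this.symm hr)

/-- With holes at a vertex `v` and at one of its neighbours `c`, the tokens at two further
neighbours `a` and `b` can be exchanged, using `v` and `c` as a siding. -/
theorem interchangeable_of_star (hr : ∀ u v, r u v → r v u) (hπ : Reach r W 1 π) {v a b c : V}
    (ha : r v a) (hb : r v b) (hc : r v c) (hva : v ≠ a) (hvb : v ≠ b) (hvc : v ≠ c)
    (hab : a ≠ b) (hac : a ≠ c) (hbc : b ≠ c)
    (hv : π.symm v ∈ W) (hcW : π.symm c ∈ W) (haW : π.symm a ∉ W) (hbW : π.symm b ∉ W) :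
    Interchangeable r W (π.symm a) (π.symm b) := by
  refine interchangeable_of_reach hr haW hbW hπ ?_
  -- read from the right: `a` moves over `v` to `c`, `b` over `v` to `a`, and `c` over `v` to `b`;
  -- the last slide exchanges the two holes, which have traded places
  have e : π * swap (π.symm a) (π.symm b) = swap v c * (swap v b * (swap c v * (swap v a *
      (swap b v * (swap v c * (swap a v * π)))))) := by
    have : π * swap (π.symm a) (π.symm b) = swap a b * π := by
      rw [mul_swap_eq_swap_mul]; simp
    rw [this]
    simp only [← mul_assoc]
    congr 1
    ext x
    simp only [Perm.mul_apply]
    by_cases h1 : x = v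
    · subst h1; simp [swap_apply_def]; grind
    by_cases h2 : x = a
    · subst h2; simp [swap_apply_def]; grind
    by_cases h3 : x = b
    · subst h3; simp [swap_apply_def]; grind
    by_cases h4 : x = c
    · subst h4; simp [swap_apply_def]; grind
    simp [swap_apply_def, *]
  rw [e]
  refine (Reach.slide (hr _ _ ha) ?_).trans <| (Reach.slide hc ?_).trans <|
    (Reach.slide (hr _ _ hb) ?_).trans <| (Reach.slide ha ?_).trans <|
    (Reach.slide (hr _ _ hc) ?_).trans <| (Reach.slide hb ?_).trans <| Reach.slide hc ?_
  all_goals simp [symm_swap_mul_apply, swap_apply_def, hv, hcW, hab, hac, hbc,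
    hva.symm, hvb.symm, hvc.symm, hab.symm, hac.symm, hbc.symm]

end Interchange

/-! ### Mixing sets of positions -/

section Mixing

variable {V : Type*} [DecidableEq V] {r : V → V → Prop} {W : Finset V}

/-- The set of positions `G` is mixing if, in every reachable state with all holes in `G`, any two
tokens located in `G` are interchangeable. -/
def Mixing (r : V → V → Prop) (W : Finset V) (G : Finset V) : Prop :=
  ∀ π, Reach r W 1 π → (∀ w ∈ W, π w ∈ G) →
    ∀ x ∉ W, ∀ y ∉ W, π x ∈ G → π y ∈ G → Interchangeable r W x y

theorem fixes_compl_mem_iff {G : Finset V} {τ : Perm V} (hτ : ∀ x ∉ (G : Set V), τ x = x) (x : V) :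
    τ x ∈ G ↔ x ∈ G := by
  by_cases hx : x ∈ G
  · refine iff_of_true ?_ hx
    by_contra h
    have := τ.injective (hτ (τ x) (by simpa using h))
    rw [this] at h
    exact h hx
  · rw [hτ x (by simpa using hx)]

/-- Two holes inside a connected set `G` can be moved to prescribed positions of `G` without
changing which tokens are located in `G`. -/
theorem exists_move_two_holes (hr : ∀ u v, r u v → r v u) (hW : W.card = 2) {G : Finset V}
    (hG : ConnectedIn r (G : Set V)) {π : Perm V} (hπ : Reach r W 1 π) (hπG : ∀ w ∈ W, π w ∈ G)
    {p h : V} (hp : p ∈ G) (hh : h ∈ G) (hph : p ≠ h) :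
    ∃ π', Reach r W 1 π' ∧ (∀ x, π' x ∈ G ↔ π x ∈ G) ∧ HolesAt W π' {p, h} := by
  obtain ⟨τ, hτ, hreach, hholes⟩ := exists_move_holes (W := W) hr hG
    (H := W.map π.toEmbedding) (H' := {p, h})
    (by rw [Finset.card_map, hW, Finset.card_pair hph])
    (by
      intro x hx
      obtain ⟨w, hw, rfl⟩ := Finset.mem_map.1 hx
      exact hπG w hw)
    (by
      intro x hx
      rcases Finset.mem_insert.1 hx with rfl | hx
      · exact hp
      · rw [Finset.mem_singleton.1 hx]; exact hh)
    π (holesAt_map W π)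
  exact ⟨τ * π, hπ.trans hreach, fun x => fixes_compl_mem_iff hτ _, hholes⟩

/-- A star with three leaves is mixing for two holes. -/
theorem mixing_star (hr : ∀ u v, r u v → r v u) (hW : W.card = 2) {v a b c : V}
    (ha : r v a) (hb : r v b) (hc : r v c) (hva : v ≠ a) (hvb : v ≠ b) (hvc : v ≠ c)
    (hab : a ≠ b) (hac : a ≠ c) (hbc : b ≠ c)
    (hconn : ConnectedIn r (({v, a, b, c} : Finset V) : Set V)) : Mixing r W {v, a, b, c} := by
  intro π hπ hπG x hx y hy hxG hyG
  obtain ⟨π', hπ', hG, hholes⟩ := exists_move_two_holes hr hW hconn hπ hπG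
    (p := v) (h := c) (by simp) (by simp) hvc
  have hab' := interchangeable_of_star hr hπ' ha hb hc hva hvb hvc hab hac hbc
    (by simp [hholes v]) (by simp [hholes c]) (by simp [hholes a, hva.symm, hac])
    (by simp [hholes b, hvb.symm, hbc])
  have key : ∀ z ∉ W, π z ∈ ({v, a, b, c} : Finset V) → z = π'.symm a ∨ z = π'.symm b := by
    intro z hz hzG
    rw [← hG] at hzG
    have := (hholes (π' z)).not.1 (by simpa using hz)
    simp only [Finset.mem_insert, Finset.mem_singleton] at this hzG
    rw [eq_symm_apply, eq_symm_apply]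
    tauto
  have hrefl : ∀ z, Interchangeable r W z z := fun z => by
    rw [Interchangeable, swap_self]; exact Reach.refl _
  rcases key x hx hxG with rfl | rfl <;> rcases key y hy hyG with rfl | rfl
  · exact hrefl _
  · exact hab'
  · exact hab'.symm
  · exact hrefl _

theorem connectedIn_star (hr : ∀ u v, r u v → r v u) {v a b c : V}
    (ha : r v a) (hb : r v b) (hc : r v c) :
    ConnectedIn r (({v, a, b, c} : Finset V) : Set V) := by
  have h₀ : ConnectedIn r ({v} : Set V) := by
    rintro u rfl w rfl
    exact ReflTransGen.refl
  have h₁ := ((h₀.insert_adj hr (by simp) hc).insert_adj hr (by simp) hb).insert_adj hr (by simp) ha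
  convert h₁ using 1
  ext x
  simp only [Finset.coe_insert, Finset.coe_singleton, Set.mem_insert_iff, Set.mem_singleton_iff]
  tauto

/-- To add an adjacent vertex `y` to a mixing set `G`, it is enough to exchange, for one placement
of the two holes in `G`, the token at `y` with some token in `G`. -/
theorem Mixing.insert_of_exists (hr : ∀ u v, r u v → r v u) (hW : W.card = 2) {G : Finset V}
    (hmix : Mixing r W G) (hconn : ConnectedIn r (G : Set V)) {y p h : V}
    (hp : p ∈ G) (hh : h ∈ G) (hph : p ≠ h) (hpy : ∃ p' ∈ G, r p' y)
    (key : ∀ π, Reach r W 1 π → HolesAt W π {p, h} →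
      ∃ z ∈ G, z ≠ p ∧ z ≠ h ∧ Interchangeable r W (π.symm y) (π.symm z)) :
    Mixing r W (insert y G) := by
  intro π hπ hπG a ha b hb haG hbG
  obtain ⟨p', hp', hpy⟩ := hpy
  have hconn' : ConnectedIn r ((insert y G : Finset V) : Set V) := by
    rw [Finset.coe_insert]; exact hconn.insert_adj hr hp' hpy
  obtain ⟨π', hπ', hG, hholes⟩ := exists_move_two_holes hr hW hconn' hπ hπG
    (Finset.mem_insert_of_mem hp) (Finset.mem_insert_of_mem hh) hph
  obtain ⟨z, hz, hzp, hzh, hyz⟩ := key π' hπ' hholes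
  have hzW : π'.symm z ∉ W := by simp [hholes z, hzp, hzh]
  have hholesG : ∀ w ∈ W, π' w ∈ G := by
    intro w hw
    have := (hholes (π' w)).1 (by simpa using hw)
    simp only [Finset.mem_insert, Finset.mem_singleton] at this
    rcases this with h | h <;> rw [h] <;> assumption
  have main : ∀ x ∉ W, π x ∈ insert y G → Interchangeable r W x (π'.symm z) := by
    intro x hx hxG
    rw [← hG] at hxG
    rcases Finset.mem_insert.1 hxG with h | h
    · rw [← h] at hyz; simpa using hyz
    · exact hmix π' hπ' hholesG x hx _ hzW h (by simpa using hz)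
  exact (main a ha haG).trans ha hzW hb (main b hb hbG).symm

/-- A neighbour `y` of a vertex `p ∈ G` with two neighbours in `G` can be added, by the exchange
on the star formed by `p` and these three vertices. -/
theorem Mixing.insert_of_two_neighbors (hr : ∀ u v, r u v → r v u) (hirr : ∀ v, ¬ r v v)
    (hW : W.card = 2) {G : Finset V}
    (hmix : Mixing r W G) (hconn : ConnectedIn r (G : Set V)) {y p p' p'' : V} (hy : y ∉ G)
    (hp : p ∈ G) (hp' : p' ∈ G) (hp'' : p'' ∈ G) (hne : p' ≠ p'') (hpy : r p y) (hpp' : r p p')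
    (hpp'' : r p p'') : Mixing r W (insert y G) := by
  have hirr' : ∀ {u v}, r u v → u ≠ v := fun h e => hirr _ (e ▸ h)
  have hyne : ∀ {q}, q ∈ G → y ≠ q := fun hq e => hy (e ▸ hq)
  refine hmix.insert_of_exists hr hW hconn hp hp' (hirr' hpp') ⟨p, hp, hpy⟩ ?_
  intro π hπ hholes
  refine ⟨p'', hp'', (hirr' hpp'').symm, hne.symm, ?_⟩
  exact interchangeable_of_star hr hπ hpy hpp'' hpp' (hirr' hpy) (hirr' hpp'') (hirr' hpp')
    (hyne hp'') (hyne hp') hne.symm (by simp [hholes p]) (by simp [hholes p'])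
    (by simp [hholes y, hyne hp, hyne hp'])
    (by simp [hholes p'', (hirr' hpp'').symm, hne.symm])

/-- A neighbour `y` of `p ∈ G` can be added if a walk outside `G` leads from `y` to another vertex
`q` of `G`. The token of `y` enters `G` at `p`, and the hole left at `y` goes around the walk to
`q`, pushing the token of `q` out of `G`. Then both holes are in `G` again, and since `G` has at
least four vertices, a token that was there before is still there. -/
theorem Mixing.insert_of_ear (hr : ∀ u v, r u v → r v u) (hW : W.card = 2) {G : Finset V}
    (hcard : 4 ≤ G.card)
    (hmix : Mixing r W G) (hconn : ConnectedIn r (G : Set V)) {y p q : V} (hy : y ∉ G)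
    (hp : p ∈ G) (hq : q ∈ G) (hqp : q ≠ p) (hpy : r p y)
    (hear : ReflTransGen (StepIn r {x | x ∉ G ∨ x = q}) y q) : Mixing r W (insert y G) := by
  -- `h` is the place of the second hole, and the token at `z` never moves
  obtain ⟨h, hhG, hh⟩ : ∃ h ∈ G, h ∉ ({p, q} : Finset V) :=
    Finset.exists_mem_notMem_of_card_lt_card (lt_of_le_of_lt Finset.card_le_two (by omega))
  obtain ⟨z, hzG, hz⟩ : ∃ z ∈ G, z ∉ ({p, q, h} : Finset V) :=
    Finset.exists_mem_notMem_of_card_lt_card (lt_of_le_of_lt Finset.card_le_three (by omega))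
  simp only [Finset.mem_insert, Finset.mem_singleton, not_or] at hh hz
  have hyne : ∀ {q}, q ∈ G → y ≠ q := fun hq e => hy (e ▸ hq)
  refine hmix.insert_of_exists hr hW hconn hp hhG (Ne.symm hh.1) ⟨p, hp, hpy⟩ ?_
  intro π hπ hholes
  refine ⟨z, hzG, hz.1, hz.2.2, ?_⟩
  obtain ⟨τ, hτ, hfix, hreach⟩ := exists_hole_walk (r := r) (A := {x | x ∉ G ∨ x = q}) (a := y)
    (b := q) (ReflTransGen.mono (fun _ _ h => ⟨hr _ _ h.1, h.2⟩) _ _ hear)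
  have hfix' : ∀ x ∈ G, x ≠ q → τ x = x := fun x hx hxq => hfix x (by simp [hx, hxq])
  -- first the token of `y` moves to `p`, then the hole left at `y` goes to `q`
  have h₁ : Reach r W 1 (τ * (swap y p * π)) :=
    (hπ.trans (Reach.slide (hr _ _ hpy) (by simp [hholes p]))).trans
      (hreach W _ (by simp [symm_swap_mul_apply, hholes p]))
  refine hmix _ h₁ ?_ _ (by simp [hholes y, hyne hp, hyne hhG]) _ (by simp [hholes z, hz]) ?_ ?_
  · intro w hw
    have := (hholes (π w)).1 (by simpa using hw)
    simp only [Finset.mem_insert, Finset.mem_singleton] at this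
    rcases this with e | e
    · simpa [e, hτ] using hq
    · rw [Perm.mul_apply, Perm.mul_apply, e,
        swap_apply_of_ne_of_ne (hyne hhG).symm hh.1, hfix' h hhG hh.2]
      exact hhG
  · simpa [hfix' p hp hqp.symm] using hp
  · rw [Perm.mul_apply, Perm.mul_apply, apply_symm_apply,
      swap_apply_of_ne_of_ne (hyne hzG).symm hz.1, hfix' z hzG hz.2.1]
    exact hzG

end Mixing

/-! ### Enlarging mixing sets in bridgeless graphs -/

section Growth

variable {V : Type*} [DecidableEq V] {r : V → V → Prop} {W : Finset V}

omit [DecidableEq V] in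
/-- A walk from `a` to `b ≠ a` yields a step out of `a` followed by a walk to `b` avoiding `a`. -/
theorem exists_last_exit {a b : V} (h : ReflTransGen r a b) (hab : a ≠ b) :
    ∃ y, r a y ∧ ReflTransGen (StepIn r {x | x ≠ a}) y b := by
  suffices ∀ u, ReflTransGen r u b →
      (∃ y, r a y ∧ ReflTransGen (StepIn r {x | x ≠ a}) y b) ∨
      (u ≠ a ∧ ReflTransGen (StepIn r {x | x ≠ a}) u b) from
    (this a h).resolve_right fun h => h.1 rfl
  intro u hu
  induction hu using ReflTransGen.head_induction_on with
  | refl => exact Or.inr ⟨hab.symm, ReflTransGen.refl⟩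
  | @head u v huv _ ih =>
    rcases ih with ih | ⟨hv, ih⟩
    · exact Or.inl ih
    · by_cases hu : u = a
      · subst hu; exact Or.inl ⟨v, huv, ih⟩
      · exact Or.inr ⟨hu, ih.head ⟨huv, hu, hv⟩⟩

omit [DecidableEq V] in
/-- A walk into `G` from outside contains an initial part that meets `G` only in its last
vertex. -/
theorem exists_first_hit {G : Set V} {y b : V} (h : ReflTransGen r y b) (hy : y ∉ G)
    (hb : b ∈ G) :
    ∃ z q, z ∉ G ∧ q ∈ G ∧ r z q ∧ ReflTransGen (StepIn r {x | x ∉ G ∨ x = q}) y q := by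
  induction h using ReflTransGen.head_induction_on with
  | refl => exact absurd hb hy
  | @head u v huv _ ih =>
    by_cases hv : v ∈ G
    · exact ⟨u, v, hy, hv, huv, ReflTransGen.single ⟨huv, Or.inl hy, Or.inr rfl⟩⟩
    · obtain ⟨z, q, hz, hq, hzq, h⟩ := ih hv
      exact ⟨z, q, hz, hq, hzq, h.head ⟨huv, Or.inl hy, Or.inl hv⟩⟩

/-- A connected mixing set of at least four vertices in a bridgeless graph can be enlarged. If no
vertex of `G` with a neighbour outside `G` has two neighbours in `G`, let `p` be one with a single
neighbour `p'` in `G`. As `p p'` is not a bridge, a walk from `p` to `p'` avoids this edge; after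
its last visit to `p` it leaves `G`, and it returns to `G` at a vertex other than `p`. -/
theorem Mixing.exists_insert (hr : ∀ u v, r u v → r v u) (hirr : ∀ v, ¬ r v v)
    (hbridge : ∀ a b u v, ReflTransGen (fun x y => r x y ∧ s(x, y) ≠ s(a, b)) u v)
    (hW : W.card = 2) {G : Finset V} (hcard : 4 ≤ G.card)
    (hmix : Mixing r W G) (hconn : ConnectedIn r (G : Set V)) (hG : ∃ v, v ∉ G) :
    ∃ y ∉ G, Mixing r W (insert y G) ∧ ConnectedIn r ((insert y G : Finset V) : Set V) := by
  suffices ∃ y ∉ G, ∃ p ∈ G, r p y ∧ Mixing r W (insert y G) by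
    obtain ⟨y, hy, p, hp, hpy, h⟩ := this
    refine ⟨y, hy, h, ?_⟩
    rw [Finset.coe_insert]
    exact hconn.insert_adj hr hp hpy
  by_cases htwo : ∃ p ∈ G, ∃ y ∉ G, r p y ∧ ∃ p' ∈ G, ∃ p'' ∈ G, p' ≠ p'' ∧ r p p' ∧ r p p''
  · obtain ⟨p, hp, y, hy, hpy, p', hp', p'', hp'', hne, h', h''⟩ := htwo
    exact ⟨y, hy, p, hp, hpy, hmix.insert_of_two_neighbors hr hirr hW hconn hy hp hp' hp'' hne
      hpy h' h''⟩
  have hconnV : ∀ u v, ReflTransGen r u v := fun u v =>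
    ReflTransGen.mono (fun _ _ h => h.1) _ _ (hbridge u u u v)
  obtain ⟨v, hv⟩ := hG
  obtain ⟨g, hg⟩ : G.Nonempty := Finset.card_pos.1 (by omega)
  obtain ⟨y₀, p, hy₀, hp, hy₀p, -⟩ :=
    exists_first_hit (G := (G : Set V)) (hconnV v g) (by simpa using hv) (by simpa using hg)
  obtain ⟨g', hg', hg'p⟩ : ∃ g' ∈ G, g' ≠ p := Finset.exists_mem_ne (by omega) p
  obtain ⟨p', hpp', hp'⟩ : ∃ p', r p p' ∧ p' ∈ G := by
    rcases (hconn p hp g' hg').cases_head with h | ⟨p', h, -⟩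
    · exact absurd h.symm hg'p
    · exact ⟨p', h.1, h.2.2⟩
  have hunique : ∀ z ∈ G, r p z → z = p' := by
    intro z hz hpz
    by_contra hne
    exact htwo ⟨p, hp, y₀, hy₀, hr _ _ hy₀p, z, hz, p', hp', hne, hpz, hpp'⟩
  have hpne : p ≠ p' := fun e => hirr p' (e ▸ hpp')
  obtain ⟨y, ⟨hpy, hedge⟩, hwalk⟩ := exists_last_exit (hbridge p p' p p') hpne
  have hy : y ∉ G := fun hyG => hedge (by rw [hunique y hyG hpy])
  obtain ⟨z, q, -, hq, hzq, hear⟩ := exists_first_hit (G := (G : Set V)) hwalk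
    (by simpa using hy) (by simpa using hp')
  refine ⟨y, hy, p, hp, hpy, hmix.insert_of_ear hr hW hcard hconn hy hp hq hzq.2.2 hpy ?_⟩
  exact ReflTransGen.mono (fun _ _ h => ⟨h.1.1.1, h.2⟩) _ _ hear

/-- In a bridgeless connected graph with a vertex that has three neighbours, the set of all
vertices is mixing for two holes. -/
theorem mixing_univ [Fintype V] (hr : ∀ u v, r u v → r v u) (hirr : ∀ v, ¬ r v v)
    (hbridge : ∀ a b u v, ReflTransGen (fun x y => r x y ∧ s(x, y) ≠ s(a, b)) u v)
    (hW : W.card = 2) {v a b c : V} (ha : r v a) (hb : r v b) (hc : r v c)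
    (hab : a ≠ b) (hac : a ≠ c) (hbc : b ≠ c) : Mixing r W Finset.univ := by
  have hirr' : ∀ {u v}, r u v → u ≠ v := fun h e => hirr _ (e ▸ h)
  suffices ∀ m, ∀ G : Finset V, Gᶜ.card = m → 4 ≤ G.card → Mixing r W G →
      ConnectedIn r (G : Set V) → Mixing r W Finset.univ from
    this _ {v, a, b, c} rfl
      (by simp [Finset.card_insert_of_notMem, hirr' ha, hirr' hb, hirr' hc, hab, hac, hbc])
      (mixing_star hr hW ha hb hc (hirr' ha) (hirr' hb) (hirr' hc) hab hac hbc
        (connectedIn_star hr ha hb hc))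
      (connectedIn_star hr ha hb hc)
  intro m
  induction m with
  | zero =>
    intro G hG _ hmix _
    rwa [(Finset.compl_eq_empty_iff _).1 (Finset.card_eq_zero.1 hG)] at hmix
  | succ m ih =>
    intro G hG hcard hmix hconn
    obtain ⟨x, hx⟩ : Gᶜ.Nonempty := Finset.card_pos.1 (by omega)
    obtain ⟨y, hy, hmix', hconn'⟩ := hmix.exists_insert hr hirr hbridge hW hcard hconn
      ⟨x, by simpa using hx⟩
    refine ih (insert y G) ?_ (hcard.trans (Finset.card_le_card (Finset.subset_insert _ _)))
      hmix' hconn'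
    rw [Finset.compl_insert, Finset.card_erase_of_mem (by simpa using hy), hG]
    rfl

/-- In a bridgeless connected graph with a vertex that has three neighbours and with at least two
holes, any two tokens are interchangeable. Turning holes into tokens only makes sliding harder, so
two of the holes suffice. -/
theorem interchangeable_of_notMem [Fintype V] (hr : ∀ u v, r u v → r v u) (hirr : ∀ v, ¬ r v v)
    (hbridge : ∀ a b u v, ReflTransGen (fun x y => r x y ∧ s(x, y) ≠ s(a, b)) u v)
    (hW : 2 ≤ W.card) {v a b c : V} (ha : r v a) (hb : r v b) (hc : r v c)
    (hab : a ≠ b) (hac : a ≠ c) (hbc : b ≠ c) {x y : V} (hx : x ∉ W) (hy : y ∉ W) :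
    Interchangeable r W x y := by
  obtain ⟨W₀, hsub, hcard⟩ := Finset.exists_subset_card_eq hW
  exact Reach.mono_holes hsub <| mixing_univ hr hirr hbridge hcard ha hb hc hab hac hbc 1
    (Reach.refl 1) (by simp) x (fun h => hx (hsub h)) y (fun h => hy (hsub h)) (by simp) (by simp)

end Growth

/-! ### Recognizing cycles -/

section CycleRecognition

variable {V : Type*}

/-- A `2`-edge connected graph in which no vertex has three neighbours is a cycle: it contains a
cycle, whose vertices have no neighbours besides those along the cycle. -/
theorem SimpleGraph.isCycleGraph_of_no_three_neighbors [Nontrivial V] {Γ : SimpleGraph V}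
    (hΓ : Γ.IsEdgeConnected 2)
    (h3 : ∀ v a b c, Γ.Adj v a → Γ.Adj v b → Γ.Adj v c → a ≠ b → a ≠ c → b ≠ c → False) :
    Γ.IsCycleGraph := by
  obtain ⟨u, v, huv⟩ := exists_pair_ne V
  obtain ⟨p, hp⟩ := exists_isCycle_of_two_le_isEdgeReachable huv le_rfl (hΓ u v)
  obtain ⟨m, hm⟩ : ∃ m, p.length = m + 3 := ⟨p.length - 3, by have := hp.three_le_length; omega⟩
  obtain ⟨⟨f, hf⟩⟩ := (cycleGraph_isContained_iff (by omega)).2 ⟨u, p, hp, hm⟩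
  have hadj : ∀ i, Γ.Adj (f i) (f (i + 1)) := fun i =>
    f.map_adj (cycleGraph_adj.2 (Or.inr (by simp)))
  have hinj : ∀ i j, f i = f j → i = j := fun i j h => hf h
  have hnbr : ∀ i x, Γ.Adj (f i) x → x = f (i - 1) ∨ x = f (i + 1) := by
    intro i x hx
    by_contra! h
    refine h3 (f i) (f (i - 1)) (f (i + 1)) x ?_ (hadj i) hx ?_ h.1.symm h.2.symm
    · simpa using (hadj (i - 1)).symm
    · intro e
      have h2 : i - 1 = i + 1 := hinj _ _ e
      -- the two neighbours along the cycle differ, because its length `m + 3` does not divide `2`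
      have h2' : (1 : Fin (m + 3)) + 1 = 0 := by
        have := sub_eq_iff_eq_add.1 h2
        rw [add_assoc] at this
        exact left_eq_add.1 this
      have h2'' := congrArg Fin.val h2'
      rw [Fin.val_add, Fin.val_one, Nat.mod_eq_of_lt (by omega)] at h2''
      simp at h2''
  have hsurj : Function.Surjective f := by
    intro x
    obtain ⟨w⟩ := hΓ.preconnected two_ne_zero (f 0) x
    suffices ∀ y z, Γ.Walk y z → (∃ i, f i = y) → ∃ i, f i = z from this _ _ w ⟨0, rfl⟩
    intro y z w
    induction w with
    | nil => exact id
    | cons h _ ih =>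
      rintro ⟨i, rfl⟩
      rcases hnbr i _ h with rfl | rfl
      · exact ih ⟨_, rfl⟩
      · exact ih ⟨_, rfl⟩
  refine ⟨m + 3, by omega, ⟨(RelIso.symm ⟨Equiv.ofBijective f ⟨hf, hsurj⟩, ?_⟩)⟩⟩
  intro i j
  change Γ.Adj (f i) (f j) ↔ _
  refine ⟨fun h => ?_, fun h => f.map_adj h⟩
  rcases hnbr i _ h with h | h
  · rw [hinj _ _ h]; exact cycleGraph_adj.2 (Or.inl (by simp))
  · rw [hinj _ _ h]; exact cycleGraph_adj.2 (Or.inr (by simp))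

end CycleRecognition

/-! ### Cyclic order of the tokens -/

section Rotation

variable {V : Type*} [DecidableEq V] {W : Finset V}

theorem List.IsRotated.filter {α : Type*} {l l' : List α} (p : α → Bool) (h : l ~r l') :
    l.filter p ~r l'.filter p := by
  obtain ⟨k, rfl⟩ := h
  rw [List.rotate_eq_drop_append_take_mod, List.filter_append]
  conv_lhs => rw [← List.take_append_drop (k % l.length) l, List.filter_append]
  exact List.isRotated_append

theorem finRange_rotate_eq {m : ℕ} (i : Fin (m + 2)) :
    ∃ l, (List.finRange (m + 2)).rotate i = i :: (i + 1) :: l := by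
  have hlen : ((List.finRange (m + 2)).rotate i).length = m + 2 := by simp
  have h₀ : ((List.finRange (m + 2)).rotate i)[0]'(by simp) = i := by
    rw [List.getElem_rotate]
    simp [Nat.mod_eq_of_lt i.2]
  have h₁ : ((List.finRange (m + 2)).rotate i)[1]'(by simp) = i + 1 := by
    rw [List.getElem_rotate]
    ext
    simp [Fin.val_add, add_comm]
  match hl : (List.finRange (m + 2)).rotate i with
  | [] => simp [hl] at hlen
  | [_] => simp [hl] at hlen
  | a :: b :: l =>
    simp only [hl, List.getElem_cons_zero, List.getElem_cons_succ] at h₀ h₁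
    exact ⟨l, by rw [h₀, h₁]⟩

/-- Read a cyclic arrangement `g` from position `0` on and drop the entries violating `p`.
Exchanging two neighbouring entries one of which is dropped changes the result at most by a
rotation; rotating first so that the reading starts at the exchanged pair removes the wrap-around
case. -/
theorem isRotated_filter_swap {α : Type*} {m : ℕ} (g : Fin (m + 2) → α) (p : α → Bool)
    (i : Fin (m + 2)) (h : p (g i) = false ∨ p (g (i + 1)) = false) :
    ((List.finRange (m + 2)).map fun j => g (swap i (i + 1) j)).filter p ~r
      ((List.finRange (m + 2)).map g).filter p := by
  obtain ⟨l, hl⟩ := finRange_rotate_eq i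
  have hrot : List.finRange (m + 2) ~r i :: (i + 1) :: l := ⟨i, hl⟩
  have hnodup : (i :: (i + 1) :: l).Nodup := hrot.nodup_iff.1 (List.nodup_finRange _)
  refine ((hrot.map _).filter p).trans (List.IsRotated.trans ?_ ((hrot.map g).filter p).symm)
  have hmap : l.map (fun j => g (swap i (i + 1) j)) = l.map g := by
    refine List.map_congr_left fun j hj => ?_
    simp only [List.nodup_cons, List.mem_cons, not_or] at hnodup
    rw [swap_apply_of_ne_of_ne]
    · rintro rfl; exact hnodup.1.2 hj
    · rintro rfl; exact hnodup.2.1 hj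
  simp only [List.map_cons, hmap, swap_apply_left, swap_apply_right]
  rcases h with h | h
  · rw [List.filter_cons_of_neg (a := g i) (by simp [h])]
    by_cases h' : p (g (i + 1)) = true
    · simpa [h', h] using List.IsRotated.refl _
    · simpa [h', h] using List.IsRotated.refl _
  · by_cases h' : p (g i) = true
    · simpa [h', h] using List.IsRotated.refl _
    · simpa [h', h] using List.IsRotated.refl _

/-- The labels of the tokens in the order in which `f` runs through the positions. -/
def tokenList {n : ℕ} (f : Fin n → V) (W : Finset V) (π : Perm V) : List V :=
  ((List.finRange n).map fun i => π.symm (f i)).filter (· ∉ W)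

/-- On a cycle, slides preserve the cyclic order of the tokens. -/
theorem tokenList_isRotated {m : ℕ} {r : V → V → Prop} (f : Fin (m + 2) ≃ V)
    (hf : ∀ u v, r u v → ∃ i, (u = f i ∧ v = f (i + 1)) ∨ (v = f i ∧ u = f (i + 1)))
    {π : Perm V} (h : Reach r W 1 π) : tokenList f W π ~r tokenList f W 1 := by
  induction h with
  | refl => exact List.IsRotated.refl _
  | @tail π _ _ h ih =>
    obtain ⟨u, v, huv, hv, rfl⟩ := h
    refine List.IsRotated.trans ?_ ih
    have key : ∀ i, (π.symm (f i) ∈ W ∨ π.symm (f (i + 1)) ∈ W) →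
        tokenList f W (swap (f i) (f (i + 1)) * π) ~r tokenList f W π := by
      intro i hi
      have := isRotated_filter_swap (fun j => π.symm (f j)) (fun x => decide (x ∉ W)) i
        (by simpa using hi)
      unfold tokenList
      convert this using 4 with j
      rw [symm_swap_mul_apply]
      simp only [swap_apply_def, f.injective.eq_iff]
      split_ifs <;> rfl
    obtain ⟨i, ⟨rfl, rfl⟩ | ⟨rfl, rfl⟩⟩ := hf u v huv
    · exact key i (Or.inr hv)
    · rw [swap_comm]; exact key i (Or.inl hv)

theorem tokenList_eq_map {n : ℕ} (f : Fin n → V) {π : Perm V} (hπ : HolesAt W π W) :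
    tokenList f W π = (tokenList f W 1).map π.symm := by
  have hmap : ∀ l : List (Fin n), ((l.map fun i => π.symm (f i)).filter (· ∉ W)) =
      ((l.map f).filter (· ∉ W)).map π.symm := by
    intro l
    induction l with
    | nil => rfl
    | cons a l ih => by_cases h : f a ∈ W <;> simp_all [hπ (f a)]
  exact hmap _

theorem finRotate_pow_val {m : ℕ} (j : ℕ) (i : Fin m) :
    ((finRotate m ^ j) i : ℕ) = (i + j) % m := by
  induction j with
  | zero => simp [Nat.mod_eq_of_lt i.2]
  | succ j ih =>
    obtain ⟨m, rfl⟩ : ∃ k, m = k + 1 := ⟨m - 1, by have := i.2; omega⟩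
    rw [pow_succ', Perm.mul_apply, finRotate_apply, Fin.val_add, ih]
    simp [add_assoc]

end Rotation

/-! ### Transporting a token -/

section Transport

variable {V : Type*} [DecidableEq V] {r : V → V → Prop} {W : Finset V}

/-- If the graph stays connected after the removal of any vertex, a token can be brought to any
position that is initially not a hole, with the holes finally back at their initial positions. -/
theorem exists_reach_apply_eq (hr : ∀ u v, r u v → r v u) (hW : W.Nonempty)
    (hconn : ∀ u v, ReflTransGen r u v) (hirr : ∀ v, ¬ r v v)
    (hdel : ∀ u, ConnectedIn r {x | x ≠ u}) {x y : V} (hx : x ∉ W) (hy : y ∉ W) :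
    ∃ π, Reach r W 1 π ∧ HolesAt W π W ∧ π x = y := by
  obtain ⟨w, hw⟩ := hW
  -- each step of the token is prepared by a hole driven ahead of it without touching the token
  have hwx : w ≠ x := fun e => hx (e ▸ hw)
  have hmove : ∀ z, ReflTransGen r x z → ∃ π, Reach r W 1 π ∧ π x = z := by
    intro z hz
    induction hz with
    | refl => exact ⟨1, Reach.refl 1, rfl⟩
    | @tail u v _ huv ih =>
      obtain ⟨π, hπ, rfl⟩ := ih
      obtain ⟨τ, hτ, hfix, hreach⟩ := exists_hole_walk (r := r) (A := {z | z ≠ π x})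
        (a := π w) (b := v) (ReflTransGen.mono (fun _ _ h => ⟨hr _ _ h.1, h.2⟩) _ _
          (hdel (π x) _ (fun e => hwx (π.injective e)) _ (fun e => hirr _ (e ▸ huv))))
      refine ⟨swap (π x) v * (τ * π), (hπ.trans (hreach W π (by simpa using hw))).trans
        (Reach.slide huv ?_), ?_⟩
      · rw [← hτ]; simpa [Perm.mul_def] using hw
      · simp [hfix (π x) (by simp)]
  obtain ⟨π, hπ, rfl⟩ := hmove y (hconn x y)
  -- the token stays in place while the holes go back to `W`
  obtain ⟨τ, hτ, hreach, hholes⟩ := exists_move_holes (W := W) hr (hdel (π x))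
    (H := W.map π.toEmbedding) (H' := W) (by simp)
    (by
      intro z hz
      obtain ⟨w, hw, rfl⟩ := Finset.mem_map.1 hz
      exact fun e => hx (π.injective e ▸ hw))
    (fun z hz e => hy (e ▸ hz)) π (holesAt_map W π)
  exact ⟨τ * π, hπ.trans hreach, hholes, by simp [hτ (π x) (by simp)]⟩

omit [DecidableEq V] in
/-- A cycle stays connected after the removal of any vertex. -/
theorem connectedIn_ne_of_cycle {m : ℕ} (hr : ∀ u v, r u v → r v u) (f : Fin (m + 2) ≃ V)
    (hf : ∀ i, r (f i) (f (i + 1))) (u : V) : ConnectedIn r {x | x ≠ u} := by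
  obtain ⟨i, rfl⟩ := f.surjective u
  have hne : ∀ j : ℕ, j + 1 < m + 2 → f (i + Fin.ofNat (m + 2) (j + 1)) ≠ f i := by
    intro j hj e
    have := f.injective e
    rw [add_eq_left] at this
    have := congrArg Fin.val this
    rw [Fin.val_ofNat, Nat.mod_eq_of_lt hj] at this
    simp at this
  have key : ∀ j : ℕ, j + 1 < m + 2 →
      ReflTransGen (StepIn r {x | x ≠ f i}) (f (i + Fin.ofNat (m + 2) (0 + 1)))
        (f (i + Fin.ofNat (m + 2) (j + 1))) := by
    intro j
    induction j with
    | zero => exact fun _ => ReflTransGen.refl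
    | succ j ih =>
      intro hj
      refine (ih (by omega)).tail ⟨?_, hne j (by omega), hne (j + 1) hj⟩
      have := hf (i + Fin.ofNat (m + 2) (j + 1))
      have hsucc : Fin.ofNat (m + 2) (j + 1) + 1 = Fin.ofNat (m + 2) (j + 1 + 1) := by
        ext; simp [Fin.val_add]
      rwa [add_assoc, hsucc] at this
  have hall : ∀ v, v ≠ f i →
      ReflTransGen (StepIn r {x | x ≠ f i}) (f (i + Fin.ofNat (m + 2) (0 + 1))) v := by
    intro v hv
    obtain ⟨k, rfl⟩ := f.surjective v
    have hk : (k - i).val ≠ 0 := fun h => hv (by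
      have : k - i = 0 := Fin.ext h
      rw [sub_eq_zero.1 this])
    have := key ((k - i).val - 1) (by have := (k - i).2; omega)
    rwa [Nat.sub_add_cancel (Nat.pos_of_ne_zero hk), Fin.ofNat_val_eq_self, add_sub_cancel] at this
  exact fun a ha b hb => ((hall a ha).stepIn_symm hr).trans (hall b hb)

end Transport

/-! ### Sliding groups -/

section Groups

variable {V : Type*} [DecidableEq V] {r : V → V → Prop} {W : Finset V}

/-- The group generated by the rearrangements of the tokens that slides can produce from the
initial state, with all holes back in `W` at the end. -/
def slideGroup (r : V → V → Prop) (W : Finset V) : Subgroup (Perm {x : V // x ∉ W}) :=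
  Subgroup.closure {σ | ∃ π, Reach r W 1 π ∧ ∀ x : {x : V // x ∉ W}, π x = σ x}

theorem slideGroup_eq_top [Finite V]
    (h : ∀ x ∉ W, ∀ y ∉ W, Interchangeable r W x y) : slideGroup r W = ⊤ := by
  rw [eq_top_iff, ← Equiv.Perm.closure_isSwap, slideGroup]
  refine Subgroup.closure_mono ?_
  rintro _ ⟨x, y, -, rfl⟩
  refine ⟨swap (x : V) y, h x x.2 y y.2, fun z => ?_⟩
  simp only [swap_apply_def, Subtype.ext_iff]
  split_ifs <;> rfl

theorem permGroupIso_symmPermGroup {α : Type*} [Fintype α] {m : ℕ}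
    (hα : Fintype.card α = m) {G : Subgroup (Perm α)} (hG : G = ⊤) :
    PermGroupIso G (symmPermGroup m) := by
  subst hG
  exact ⟨Fintype.equivFinOfCardEq hα,
    Subgroup.map_top_of_surjective _ (Fintype.equivFinOfCardEq hα).permCongrHom.surjective⟩

theorem holesAt_self_of_restricts {π : Perm V} {σ : Perm {x : V // x ∉ W}}
    (h : ∀ x : {x : V // x ∉ W}, π x = σ x) : HolesAt W π W := by
  intro x
  constructor
  · intro hx
    by_contra hxW
    have := h (σ.symm ⟨x, hxW⟩)
    rw [apply_symm_apply, ← eq_symm_apply] at this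
    exact (σ.symm ⟨x, hxW⟩).2 (this ▸ hx)
  · intro hx
    by_contra hxW
    have := h ⟨_, hxW⟩
    rw [apply_symm_apply] at this
    exact (σ ⟨_, hxW⟩).2 (this ▸ hx)

/-- A power of the rotation is determined by its value at one point. -/
theorem eq_finRotate_of_mem_zpowers {m : ℕ} {ρ : Perm (Fin m)}
    (hρ : ρ ∈ Subgroup.zpowers (finRotate m)) {i₀ : Fin m} (hi₀ : (i₀ : ℕ) = 0)
    (h0 : ρ i₀ = finRotate m i₀) : ρ = finRotate m := by
  obtain ⟨z, rfl⟩ := Subgroup.mem_zpowers_iff.1 hρ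
  ext1 i
  have hi : (finRotate m ^ (i : ℕ)) i₀ = i := by
    ext; rw [finRotate_pow_val, hi₀]; simp [Nat.mod_eq_of_lt i.2]
  have hcomm : ∀ x y : ℤ, finRotate m ^ x * finRotate m ^ y =
      finRotate m ^ y * finRotate m ^ x := fun x y => zpow_mul_comm _ x y
  have h1 := congrArg (fun τ : Perm (Fin m) => τ i₀) (hcomm z i)
  have h2 := congrArg (fun τ : Perm (Fin m) => τ i₀) (hcomm 1 i)
  simp only [zpow_natCast, zpow_one, Perm.mul_apply, hi] at h1 h2
  rw [h1, h0, h2]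

omit [DecidableEq V] in
theorem reflTransGen_of_cycle {m : ℕ} (f : Fin (m + 1) ≃ V) (hf : ∀ i, r (f i) (f (i + 1)))
    (u v : V) : ReflTransGen r u v := by
  obtain ⟨i, rfl⟩ := f.surjective u
  obtain ⟨k, rfl⟩ := f.surjective v
  have key : ∀ j : ℕ, ReflTransGen r (f i) (f (i + Fin.ofNat (m + 1) j)) := by
    intro j
    induction j with
    | zero =>
      have : Fin.ofNat (m + 1) 0 = 0 := rfl
      rw [this, add_zero]
    | succ j ih =>
      have hsucc : Fin.ofNat (m + 1) j + 1 = Fin.ofNat (m + 1) (j + 1) := by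
        ext; simp [Fin.val_add]
      have := ih.tail (hf _)
      rwa [add_assoc, hsucc] at this
  have := key (k - i).val
  rwa [Fin.ofNat_val_eq_self, add_sub_cancel] at this

/-- On a cycle the sliding group is cyclic, generated by the rotation of the tokens. Each of its
generators preserves the cyclic order of the tokens, hence is a power of the rotation; and one of
them takes the first token to the place of the second, hence is the rotation itself. -/
theorem permGroupIso_cyclicPermGroup_slideGroup {m : ℕ} (f : Fin (m + 2) ≃ V)
    (hr : ∀ u v, r u v ↔ ∃ i, (u = f i ∧ v = f (i + 1)) ∨ (v = f i ∧ u = f (i + 1)))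
    (hW : W.Nonempty) (hW' : W.card < m + 2) :
    PermGroupIso (slideGroup r W) (cyclicPermGroup (m + 2 - W.card)) := by
  set L := tokenList f W 1 with hL
  have hnodup : L.Nodup := ((List.nodup_finRange _).map f.injective).filter _
  have hmem : ∀ x, x ∈ L ↔ x ∉ W := by
    intro x
    simp only [hL, tokenList, List.mem_filter, List.mem_map, List.mem_finRange, true_and,
      decide_eq_true_eq]
    exact ⟨fun h => h.2, fun h => ⟨⟨f.symm x, f.apply_symm_apply x⟩, h⟩⟩
  let e : Fin L.length ≃ {x : V // x ∉ W} :=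
    (hnodup.getEquiv L).trans (Equiv.subtypeEquivRight hmem)
  have he : ∀ i, (e i : V) = L[i] := fun i => rfl
  have hlen : L.length = m + 2 - W.card := by
    have : Fintype V := Fintype.ofEquiv _ f
    have h1 := Fintype.card_congr e
    have h2 : Fintype.card V = m + 2 := by simpa using (Fintype.card_congr f).symm
    rw [Fintype.card_fin, Fintype.card_subtype_compl, h2] at h1
    simpa using h1
  rw [← hlen]
  have hgen : ∀ (π : Perm V) (σ : Perm {x : V // x ∉ W}), Reach r W 1 π →
      (∀ x : {x : V // x ∉ W}, π x = σ x) →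
      e.symm.permCongrHom σ ∈ Subgroup.zpowers (finRotate L.length) := by
    intro π σ hπ hσ
    obtain ⟨j, hj⟩ := (tokenList_isRotated f (fun u v => (hr u v).1) hπ).symm
    rw [tokenList_eq_map f (holesAt_self_of_restricts hσ), ← hL] at hj
    -- the label in the place of the `i`-th token is the `(i + j)`-th token, which describes `σ⁻¹`
    have key : e.symm.permCongrHom σ⁻¹ = finRotate L.length ^ j := by
      ext1 i
      change e.symm (σ.symm (e i)) = _
      rw [symm_apply_eq, symm_apply_eq]
      apply Subtype.ext
      rw [← hσ, he, he, ← symm_apply_eq]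
      have h1 : (L.map π.symm)[(i : ℕ)]'(by simp) = π.symm L[i] := by simp
      rw [← h1]
      simp only [← hj, List.getElem_rotate]
      congr 1
      exact (finRotate_pow_val j i).symm
    rw [← inv_mem_iff, ← map_inv, key]
    exact Subgroup.npow_mem_zpowers _ _
  refine ⟨e.symm, le_antisymm ?_ ?_⟩
  · rw [Subgroup.map_le_iff_le_comap, slideGroup, Subgroup.closure_le]
    rintro σ ⟨π, hπ, hσ⟩
    exact hgen π σ hπ hσ
  · rw [cyclicPermGroup, Subgroup.zpowers_le]
    have hrsymm : ∀ u v, r u v → r v u := fun u v h => by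
      obtain ⟨i, hi⟩ := (hr u v).1 h
      exact (hr v u).2 ⟨i, hi.symm⟩
    have hf : ∀ i, r (f i) (f (i + 1)) := fun i => (hr _ _).2 ⟨i, Or.inl ⟨rfl, rfl⟩⟩
    let i₀ : Fin L.length := ⟨0, by omega⟩
    have hirr : ∀ v, ¬ r v v := fun v hv => by
      obtain ⟨i, ⟨h, h'⟩ | ⟨h, h'⟩⟩ := (hr v v).1 hv
      all_goals exact one_ne_zero (add_eq_left.1 (f.injective (h'.symm.trans h)))
    obtain ⟨π, hπ, hholes, hval⟩ := exists_reach_apply_eq hrsymm hW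
      (reflTransGen_of_cycle f hf) hirr (connectedIn_ne_of_cycle hrsymm f hf)
      (e i₀).2 (e (finRotate _ i₀)).2
    let σ : Perm {x : V // x ∉ W} := π.subtypePerm fun x => by
      rw [← hholes (π x), symm_apply_apply]
    have hσ : ∀ x : {x : V // x ∉ W}, π x = σ x := fun x => rfl
    refine ⟨σ, Subgroup.subset_closure ⟨π, hπ, hσ⟩, ?_⟩
    refine eq_finRotate_of_mem_zpowers (hgen π σ hπ hσ) (i₀ := i₀) rfl ?_
    change e.symm (σ (e i₀)) = _
    rw [symm_apply_eq]
    exact Subtype.ext hval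

end Groups

/-! ### Graphs and antisymmetric digraphs -/

section Graphs

variable {V : Type*}

theorem SimpleGraph.IsEdgeConnected.reflTransGen_avoiding {Γ : SimpleGraph V}
    (h : Γ.IsEdgeConnected 2) (a b u v : V) :
    ReflTransGen (fun x y => Γ.Adj x y ∧ s(x, y) ≠ s(a, b)) u v := by
  have := (SimpleGraph.reachable_iff_reflTransGen u v).1
    (SimpleGraph.isEdgeConnected_two.1 h s(a, b) u v)
  exact ReflTransGen.mono (fun x y h => by simpa using h) _ _ this

/-- An arc `a → b` of a strongly connected antisymmetric digraph is not a bridge: a directed walk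
from `b` to `a`, stopped when it first arrives at `a`, never uses `a → b`, and `b → a` is not an
arc. -/
theorem Digraph.IsAntisymmetric.isEdgeConnected_two {D : Digraph V} (hD : D.StronglyConnected)
    (hanti : D.IsAntisymmetric) : D.toSimpleGraphInclusive.IsEdgeConnected 2 := by
  rw [SimpleGraph.isEdgeConnected_two]
  have hadj : ∀ {a b}, D.Adj a b → D.toSimpleGraphInclusive.Adj a b := fun {a b} h =>
    (SimpleGraph.fromRel_adj _ _ _).2 ⟨fun e => hanti a b h (by rw [← e] at h ⊢; exact h), Or.inl h⟩
  have hfirst : ∀ {a v}, ReflTransGen D.Adj v a →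
      ReflTransGen (fun x y => D.Adj x y ∧ x ≠ a) v a := by
    intro a v h
    induction h using ReflTransGen.head_induction_on with
    | refl => exact ReflTransGen.refl
    | @head u w huw _ ih =>
      by_cases hu : u = a
      · rw [hu]
      · exact ih.head ⟨huw, hu⟩
  intro e u v
  have hreach : ∀ {a b}, D.Adj a b → (D.toSimpleGraphInclusive.deleteEdges {e}).Reachable a b := by
    intro a b hab
    by_cases he : s(a, b) = e
    · refine SimpleGraph.Reachable.symm ((SimpleGraph.reachable_iff_reflTransGen _ _).2 ?_)
      refine ReflTransGen.mono (fun x y h => ?_) _ _ (hfirst (hD b a))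
      refine SimpleGraph.deleteEdges_adj.2 ⟨hadj h.1, ?_⟩
      rw [Set.mem_singleton_iff, ← he, Sym2.eq_iff]
      rintro (⟨h', -⟩ | ⟨rfl, rfl⟩)
      · exact h.2 h'
      · exact hanti _ _ hab h.1
    · exact (SimpleGraph.deleteEdges_adj.2 ⟨hadj hab, by simpa using he⟩).reachable
  induction hD u v with
  | refl => exact SimpleGraph.Reachable.refl _
  | tail _ h ih => exact ih.trans (hreach h)

variable [DecidableEq V] {W : Finset V}

theorem SimpleGraph.slideGroup_of_isCycleGraph [Fintype V] {Γ : SimpleGraph V}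
    (hΓ : Γ.IsCycleGraph) (hW : W.Nonempty) (hW' : W.card < Fintype.card V) :
    PermGroupIso (slideGroup Γ.Adj W) (cyclicPermGroup (Fintype.card V - W.card)) := by
  obtain ⟨n, hn, ⟨φ⟩⟩ := hΓ
  have hcard : Fintype.card V = n := by simpa using Fintype.card_congr φ.toEquiv
  obtain ⟨m, rfl⟩ : ∃ m, n = m + 2 := ⟨n - 2, by omega⟩
  rw [hcard] at hW' ⊢
  refine permGroupIso_cyclicPermGroup_slideGroup φ.symm.toEquiv (fun u v => ?_) hW hW'
  rw [← φ.map_adj_iff, cycleGraph_adj]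
  change _ ↔ ∃ i, (u = φ.symm i ∧ v = φ.symm (i + 1)) ∨ (v = φ.symm i ∧ u = φ.symm (i + 1))
  constructor
  · rintro (h | h)
    · exact ⟨φ v, Or.inr ⟨by simp, by rw [← h]; simp⟩⟩
    · exact ⟨φ u, Or.inl ⟨by simp, by rw [← h]; simp⟩⟩
  · rintro ⟨i, ⟨rfl, rfl⟩ | ⟨rfl, rfl⟩⟩
    · right; simp
    · left; simp

theorem SimpleGraph.slideGroup_of_not_isCycleGraph [Fintype V] {Γ : SimpleGraph V}
    (h2 : Γ.IsEdgeConnected 2) (hΓ : ¬ Γ.IsCycleGraph) (hW : 2 ≤ W.card)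
    (hW' : W.card < Fintype.card V) :
    PermGroupIso (slideGroup Γ.Adj W) (symmPermGroup (Fintype.card V - W.card)) := by
  have : Nontrivial V := Fintype.one_lt_card_iff_nontrivial.1 (by omega)
  refine permGroupIso_symmPermGroup (by rw [Fintype.card_subtype_compl]; simp) ?_
  refine slideGroup_eq_top fun x hx y hy => ?_
  obtain ⟨v, a, b, c, ha, hb, hc, hab, hac, hbc⟩ : ∃ v a b c, Γ.Adj v a ∧ Γ.Adj v b ∧ Γ.Adj v c ∧
      a ≠ b ∧ a ≠ c ∧ b ≠ c := by
    by_contra! h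
    exact hΓ (isCycleGraph_of_no_three_neighbors h2 fun v a b c ha hb hc hab hac hbc =>
      hbc (h v a b c ha hb hc hab hac))
  exact interchangeable_of_notMem (fun _ _ h => h.symm) (fun v h => h.ne rfl)
    h2.reflTransGen_avoiding hW ha hb hc hab hac hbc hx hy

theorem defectGroup_eq_slideGroup [Fintype V] {D : Digraph V}
    (hD : D.StronglyConnected) (hW : W.Nonempty) (hW' : W.card < Fintype.card V) :
    defectGroup D.flowSemigroup W = slideGroup D.Adj W := by
  obtain ⟨t, -, ht⟩ := Finset.exists_mem_notMem_of_card_lt_card (s := W) (t := Finset.univ)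
    (by simpa using hW')
  exact defectGroup_eq_closure_reach hW fun w => ⟨t, ht, hD w t⟩

theorem slideGroup_toSimpleGraphInclusive [Fintype V] {D : Digraph V}
    (hD : D.StronglyConnected) (hanti : D.IsAntisymmetric) :
    slideGroup D.toSimpleGraphInclusive.Adj W = slideGroup D.Adj W := by
  have : ∀ π, Reach D.toSimpleGraphInclusive.Adj W 1 π ↔ Reach D.Adj W 1 π := fun π =>
    reach_iff_of_stronglyConnected hD
      (fun u v h => (SimpleGraph.fromRel_adj _ _ _).2
        ⟨fun e => hanti u v h (by rw [← e] at h ⊢; exact h), Or.inl h⟩)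
      (fun u v h => ((SimpleGraph.fromRel_adj _ _ _).1 h).2)
  simp only [slideGroup, this]

end Graphs

/-! ### The two classes of graphs -/

theorem theorem5 {V : Type*} [Fintype V] [DecidableEq V] (n k : ℕ)
    (hn : Fintype.card V = n) (hk : 2 ≤ k) (hkn : k < n) :
    -- 2-edge connected simple graphs
    (∀ Γ : SimpleGraph V, Γ.IsEdgeConnected 2 →
      ∀ W : Finset V, W.card = k →
        (Γ.IsCycleGraph →
          PermGroupIso (defectGroup Γ.flowSemigroup W) (cyclicPermGroup (n - k))) ∧
        (¬ Γ.IsCycleGraph →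
          PermGroupIso (defectGroup Γ.flowSemigroup W) (symmPermGroup (n - k)))) ∧
    -- strongly connected antisymmetric digraphs
    (∀ D : Digraph V, D.StronglyConnected → D.IsAntisymmetric →
      ∀ W : Finset V, W.card = k →
        (D.toSimpleGraphInclusive.IsCycleGraph →
          PermGroupIso (defectGroup D.flowSemigroup W) (cyclicPermGroup (n - k))) ∧
        (¬ D.toSimpleGraphInclusive.IsCycleGraph →
          PermGroupIso (defectGroup D.flowSemigroup W) (symmPermGroup (n - k)))) := by
  subst hn
  have main : ∀ (D : Digraph V) (Γ : SimpleGraph V), D.StronglyConnected →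
      Γ.IsEdgeConnected 2 → ∀ W : Finset V, W.card = k →
      slideGroup Γ.Adj W = slideGroup D.Adj W →
        (Γ.IsCycleGraph → PermGroupIso (defectGroup D.flowSemigroup W)
          (cyclicPermGroup (Fintype.card V - k))) ∧
        (¬ Γ.IsCycleGraph → PermGroupIso (defectGroup D.flowSemigroup W)
          (symmPermGroup (Fintype.card V - k))) := by
    rintro D Γ hD hΓ W rfl hslide
    have hW : W.Nonempty := Finset.card_pos.1 (by omega)
    rw [defectGroup_eq_slideGroup hD hW hkn, ← hslide]
    exact ⟨fun h => SimpleGraph.slideGroup_of_isCycleGraph h hW hkn,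
      fun h => SimpleGraph.slideGroup_of_not_isCycleGraph hΓ h hk hkn⟩
  refine ⟨fun Γ hΓ W hW => main Γ.bidirected Γ (fun u v => ?_) hΓ W hW rfl,
    fun D hD hanti W hW => main D _ hD (hanti.isEdgeConnected_two hD) W hW
      (slideGroup_toSimpleGraphInclusive hD hanti)⟩
  exact (SimpleGraph.reachable_iff_reflTransGen u v).1 (hΓ.preconnected two_ne_zero u v)
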